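/- Let $d,L\ge 1$ be integers, $\beta>0$ and $t,t',\mu\in\mathbb R$. Let $\Gamma=\mathbb Z^d/(L\mathbb Z)^d$ and $\Gamma^*=(2\pi\mathbb Z/L)^d/(2\pi\mathbb Z)^d$, write $\langle\mathbf a,\mathbf b\rangle=\sum_{l=1}^d a_lb_l$, and for $\mathbf k=(k_1,\dots,k_d)\in\Gamma^*$ put $$E_{\mathbf k}=-2t\sum_{j=1}^d\cos k_j-4t'\,1_{d\ge2}\sum_{1\le j<l\le d}\cos k_j\cos k_l-\mu .$$ For $\mathbf x,\mathbf y\in\Gamma$, $\sigma,\tau\in\{\uparrow,\downarrow\}$ and $x,y\in[0,\beta]$ define $$C(\mathbf x\sigma x,\mathbf y\tau y)=\frac{\delta_{\sigma,\tau}}{L^d}\sum_{\mathbf k\in\Gamma^*}e^{i\langle\mathbf k,\mathbf y-\mathbf x\rangle}e^{-(y-x)E_{\mathbf k}}\left(\frac{1_{y-x\le0}}{1+e^{\beta E_{\mathbf k}}}-\frac{1_{y-x>0}}{1+e^{-\beta E_{\mathbf k}}}\right).$$ For a family $U=\{U_{\mathcal X}\}_{\mathcal X\in\Gamma^4}$ of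 complex numbers and $n\ge1$ set $$T_n(U)=\frac1{n!}\sum_{\substack{\mathbf x_1,\dots,\mathbf x_{2n}\in\Gamma\\ \mathbf y_1,\dots,\mathbf y_{2n}\in\Gamma}}\ \sum_{\sigma_1,\dots,\sigma_{2n}\in\{\uparrow,\downarrow\}}\ \prod_{j=1}^n\left(-\delta_{\sigma_{2j-1},\uparrow}\delta_{\sigma_{2j},\downarrow}U_{\mathbf x_{2j-1},\mathbf x_{2j},\mathbf y_{2j-1},\mathbf y_{2j}}\right)\int_{[0,\beta]^n}\det\big(C(\mathbf x_j\sigma_jx_j,\mathbf y_k\sigma_kx_k)\big)_{1\le j,k\le2n}\Big|_{x_{2j}=x_{2j-1}\ \forall j}\,dx_1dx_3\cdots dx_{2n-1},$$ and $P(U)=1+\sum_{n=1}^\infty T_n(U)$. For $h\in\mathbb N/\beta=\{m/\beta: m=1,2,3,\dots\}$ let $[0,\beta)_h=\{0,\frac1h,\frac2h,\dots,\beta-\frac1h\}$ and define the time-discretized series $$P_h(U)=1+\sum_{n=1}^{L^d\beta h}\frac1{n!}\sum_{\substack{\mathbf x_1,\dots,\mathbf x_{2n}\in\Gamma\\ \mathbf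 y_1,\dots,\mathbf y_{2n}\in\Gamma}}\ \sum_{\sigma_1,\dots,\sigma_{2n}\in\{\uparrow,\downarrow\}}\ \sum_{x_1,\dots,x_{2n}\in[0,\beta)_h}\ \prod_{j=1}^n\left(-\frac1h\,\delta_{\sigma_{2j-1},\uparrow}\delta_{\sigma_{2j},\downarrow}\delta_{x_{2j-1},x_{2j}}U_{\mathbf x_{2j-1},\mathbf x_{2j},\mathbf y_{2j-1},\mathbf y_{2j}}\right)\det\big(C(\mathbf x_j\sigma_jx_j,\mathbf y_k\sigma_kx_k)\big)_{1\le j,k\le2n}.$$ Then the integrals in $T_n(U)$ exist and the series $P(U)$ converges absolutely for every $U\in\mathbb C^{\Gamma^4}$, and for every $r>0$ $$\lim_{\substack{h\to+\infty\\ h\in\mathbb N/\beta}}\ \sup_{\substack{U\in\mathbb C^{\Gamma^4}\\ |U_{\mathcal X}|\le r\ \forall\mathcal X\in\Gamma^4}}\big|P_h(U)-P(U)\big|=0 .$$ -/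

import Mathlib

open MeasureTheory Filter Topology

namespace Hubbard

/-- The two spin values. -/
inductive Spin : Type
  | up : Spin
  | down : Spin
  deriving DecidableEq

instance : Fintype Spin := ⟨{Spin.up, Spin.down}, fun σ => by cases σ <;> simp⟩

/-- The spatial lattice `Γ = ℤ^d / (Lℤ)^d`. -/
abbrev Site (d L : ℕ) : Type := Fin d → ZMod L

/-- Kronecker's delta, with complex values. -/
def delta {S : Type*} [DecidableEq S] (a b : S) : ℂ := if a = b then 1 else 0

/-- The momentum lattice `Γ* = (2πℤ/L)^d / (2πℤ)^d`, indexed by `p ∈ (ℤ/Lℤ)^d`: this is the `j`-th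
coordinate of the representative `k = 2πp/L` in `[0, 2π)^d`. -/
noncomputable def momentum {d L : ℕ} (p : Fin d → ZMod L) (j : Fin d) : ℝ :=
  2 * Real.pi * ((p j).val : ℝ) / (L : ℝ)

/-- The pairing `⟨k, x⟩ = ∑ j, k_j x_j` of a momentum and a site, computed on representatives; it is
well defined modulo `2π`, and is used only inside `exp (i ⟨k, x⟩)`. -/
noncomputable def pairing {d L : ℕ} (p : Fin d → ZMod L) (x : Site d L) : ℝ :=
  ∑ j, momentum p j * ((x j).val : ℝ)

/-- The dispersion relation `E_k`. -/
noncomputable def dispersion {d L : ℕ} (t t' μ : ℝ) (p : Fin d → ZMod L) : ℝ :=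
  -2 * t * ∑ j, Real.cos (momentum p j)
    - 4 * t' * (if 2 ≤ d then 1 else 0) *
        ∑ j, ∑ k ∈ Finset.Ioi j, Real.cos (momentum p j) * Real.cos (momentum p k)
    - μ

/-- The free covariance `C(𝐱σx, 𝐲τy)`. -/
noncomputable def covariance {d L : ℕ} [NeZero L] (β t t' μ : ℝ)
    (X : Site d L) (σ : Spin) (x : ℝ) (Y : Site d L) (τ : Spin) (y : ℝ) : ℂ :=
  delta σ τ / (L : ℂ) ^ d *
    ∑ p : Fin d → ZMod L,
      Complex.exp (Complex.I * (pairing p (Y - X) : ℂ)) *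
        ((Real.exp (-(y - x) * dispersion t t' μ p) *
          ((if y - x ≤ 0 then 1 else 0) / (1 + Real.exp (β * dispersion t t' μ p))
            - (if 0 < y - x then 1 else 0) / (1 + Real.exp (-(β * dispersion t t' μ p)))) : ℝ) : ℂ)

/-- The set of the `2n` indices occurring at order `n`: the pair `(j, 0)` plays the role of `2j-1`
and `(j, 1)` that of `2j`. -/
abbrev Idx (n : ℕ) : Type := Fin n × Fin 2

/-- `det (C(𝐱_j σ_j x_j, 𝐲_k σ_k x_k))_{1 ≤ j, k ≤ 2n}`. -/
noncomputable def covDet {d L : ℕ} [NeZero L] (β t t' μ : ℝ) {n : ℕ}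
    (X Y : Idx n → Site d L) (σ : Idx n → Spin) (x : Idx n → ℝ) : ℂ :=
  (Matrix.of fun a b : Idx n =>
    covariance β t t' μ (X a) (σ a) (x a) (Y b) (σ b) (x b)).det

/-- A family of complex couplings `{U_𝒳}`, `𝒳 ∈ Γ^4`. -/
abbrev Coupling (d L : ℕ) : Type := Site d L × Site d L × Site d L × Site d L → ℂ

/-- The order `n` term of the perturbation series `P`. The integral runs over the `n` free times
`s_j = x_{2j-1} = x_{2j}` in `[0, β]`. -/
noncomputable def seriesTerm {d L : ℕ} [NeZero L] (β t t' μ : ℝ) (U : Coupling d L) (n : ℕ) : ℂ :=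
  (1 / (n.factorial : ℂ)) *
    ∑ X : Idx n → Site d L, ∑ Y : Idx n → Site d L, ∑ σ : Idx n → Spin,
      (∏ j : Fin n,
        -(delta (σ (j, 0)) Spin.up * delta (σ (j, 1)) Spin.down *
          U (X (j, 0), X (j, 1), Y (j, 0), Y (j, 1)))) *
      ∫ s in Set.Icc (0 : Fin n → ℝ) (fun _ => β),
        covDet β t t' μ X Y σ (fun a => s a.1)

/-- The partition function series `P({U_𝒳})`. -/
noncomputable def partitionSeries {d L : ℕ} [NeZero L] (β t t' μ : ℝ) (U : Coupling d L) : ℂ :=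
  1 + ∑' n : ℕ, seriesTerm β t t' μ U (n + 1)

/-- The grid `[0, β)_h = {0, 1/h, 2/h, …, β - 1/h}`; here `m = β h`, that is `h = m / β`. -/
noncomputable def timeGrid (β : ℝ) (m : ℕ) : Finset ℝ :=
  (Finset.range m).image fun l : ℕ => (l : ℝ) / ((m : ℝ) / β)

/-- The order `n` term of the discretized series `P_h` with `h = m / β`. -/
noncomputable def discreteTerm {d L : ℕ} [NeZero L] (β t t' μ : ℝ) (m : ℕ)
    (U : Coupling d L) (n : ℕ) : ℂ :=
  (1 / (n.factorial : ℂ)) *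
    ∑ X : Idx n → Site d L, ∑ Y : Idx n → Site d L, ∑ σ : Idx n → Spin,
      ∑ x ∈ Fintype.piFinset (fun _ : Idx n => timeGrid β m),
        (∏ j : Fin n,
          -(1 / ((m : ℂ) / (β : ℂ)) *
            (delta (σ (j, 0)) Spin.up * delta (σ (j, 1)) Spin.down * delta (x (j, 0)) (x (j, 1)) *
              U (X (j, 0), X (j, 1), Y (j, 0), Y (j, 1))))) *
        covDet β t t' μ X Y σ x

/-- The discretized partition function `P_h({U_𝒳})` with `h = m / β`, a sum over the orders
`n = 1, …, L^d β h = L^d m`. -/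
noncomputable def discretePartition {d L : ℕ} [NeZero L] (β t t' μ : ℝ) (m : ℕ)
    (U : Coupling d L) : ℂ :=
  1 + ∑ n ∈ Finset.Icc 1 (L ^ d * m), discreteTerm β t t' μ m U n

end Hubbard

/-!
The heart of the matter is a bound `‖det‖ ≤ K ^ n` for the determinants of order `2 n`, uniform in
the sites, spins and times (`Hubbard.exists_norm_covDet_le`). Plain Hadamard would give an extra
factor of the size of `n!`, which the prefactor `1 / n!` could not absorb for large couplings. For
fixed sites and spins, however, an entry of the matrix depends on the time of its row in a Lipschitz
way apart from one jump. Hence, if the rows are ordered by site, spin and then time, each column has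
total variation bounded independently of `n`. Subtracting from every row its predecessor does not
change the determinant, and turns the squared `ℓ²` norm of each column into a quantity bounded
independently of `n`; Hadamard's inequality in its Frobenius norm form (`Hubbard.norm_det_sq_le`)
then gives the bound (`Hubbard.norm_det_sq_le_of_variation`).

With this bound the order `n` terms of both series are dominated, uniformly in `h` and on the
polydisc `|U_𝒳| ≤ r`, by `2 * c ^ n / n!`. At fixed order, the sum over the grid is the integral of
the determinant with times rounded down to the grid (`Hubbard.sum_timeGrid_eq_integral`). The
determinant is continuous where the times are pairwise distinct, which is almost everywhere, so
these integrals converge by dominated convergence (`Hubbard.tendsto_detRiemannSum`). Dominated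
convergence for series then handles the sum over all orders.
-/

namespace Hubbard

/-! ### Determinants of matrices whose columns have bounded variation -/

/-- The inequality of arithmetic and geometric means, in the form `∏ z ≤ c ^ card` as soon as the
mean of `z` is at most `c`. -/
lemma prod_le_pow_card_of_sum_le {ι : Type*} [Fintype ι] {z : ι → ℝ} (hz : ∀ i, 0 ≤ z i)
    {c : ℝ} (hc : 0 < c) (h : ∑ i, z i ≤ c * Fintype.card ι) :
    ∏ i, z i ≤ c ^ Fintype.card ι := by
  have h1 : ∀ i, z i ≤ c * Real.exp (z i / c - 1) := fun i => by
    have := Real.add_one_le_exp (z i / c - 1)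
    rw [sub_add_cancel, div_le_iff₀ hc] at this
    linarith
  calc ∏ i, z i ≤ ∏ i, c * Real.exp (z i / c - 1) :=
        Finset.prod_le_prod (fun i _ => hz i) fun i _ => h1 i
    _ = c ^ Fintype.card ι * Real.exp ((∑ i, z i) / c - Fintype.card ι) := by
        rw [Finset.prod_mul_distrib, ← Real.exp_sum, Finset.sum_sub_distrib, Finset.sum_div]
        simp
    _ ≤ c ^ Fintype.card ι * 1 := by
        gcongr
        rw [Real.exp_le_one_iff, sub_nonpos, div_le_iff₀ hc]
        linarith
    _ = _ := mul_one _

open scoped ComplexOrder in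
/-- A form of Hadamard's inequality: the determinant is controlled by the Frobenius norm, because
the eigenvalues of `A * Aᴴ` have product `‖det A‖ ^ 2` and sum `∑ ‖A a b‖ ^ 2`. -/
lemma norm_det_sq_le {ι : Type*} [Fintype ι] [DecidableEq ι] (A : Matrix ι ι ℂ)
    {c : ℝ} (hc : 0 < c) (h : ∑ a, ∑ b, ‖A a b‖ ^ 2 ≤ c * Fintype.card ι) :
    ‖A.det‖ ^ 2 ≤ c ^ Fintype.card ι := by
  have hP : (A * A.conjTranspose).PosSemidef := Matrix.posSemidef_self_mul_conjTranspose A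
  have htr : ∑ i, hP.isHermitian.eigenvalues i = ∑ a, ∑ b, ‖A a b‖ ^ 2 := by
    have h1 := hP.isHermitian.trace_eq_sum_eigenvalues
    have h2 : (A * A.conjTranspose).trace = ((∑ a, ∑ b, ‖A a b‖ ^ 2 : ℝ) : ℂ) := by
      simp [Matrix.trace, Matrix.mul_apply, Complex.mul_conj, Complex.normSq_eq_norm_sq]
    rw [h2] at h1
    exact Complex.ofReal_injective ((Complex.ofReal_sum _ _).trans h1.symm)
  have hdet : ∏ i, hP.isHermitian.eigenvalues i = ‖A.det‖ ^ 2 := by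
    have h1 := hP.isHermitian.det_eq_prod_eigenvalues
    rw [Matrix.det_mul, Matrix.det_conjTranspose, Complex.star_def, Complex.mul_conj,
      Complex.normSq_eq_norm_sq] at h1
    exact Complex.ofReal_injective ((Complex.ofReal_prod _ _).trans h1.symm)
  rw [← hdet]
  exact prod_le_pow_card_of_sum_le hP.eigenvalues_nonneg hc (htr.trans_le h)

/-- The case of `norm_det_sq_le_of_variation` in which the rows are already in increasing order. -/
lemma norm_det_sq_le_of_monotone {m : ℕ} (A : Matrix (Fin (m + 1)) (Fin (m + 1)) ℂ)
    (Φ : Fin (m + 1) → Fin (m + 1) → ℝ) {K : ℝ} (hK : 0 < K)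
    (hA : ∀ a b, ‖A a b‖ ≤ K) (hΦ0 : ∀ b a, 0 ≤ Φ b a) (hΦK : ∀ b a, Φ b a ≤ K)
    (hv : ∀ b (a : Fin m), ‖A a.succ b - A a.castSucc b‖ ≤ Φ b a.succ - Φ b a.castSucc) :
    ‖A.det‖ ^ 2 ≤ (2 * K ^ 2) ^ (m + 1) := by
  set B : Matrix (Fin (m + 1)) (Fin (m + 1)) ℂ :=
    Matrix.of (Fin.cons (A 0) fun i j => A i.succ j - A i.castSucc j) with hB
  have hdet : A.det = B.det := by
    refine Matrix.det_eq_of_forall_row_eq_smul_add_pred (fun _ => 1) (fun j => ?_) fun i j => ?_ <;>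
      simp [hB]
  have hF : ∑ a, ∑ b, ‖B a b‖ ^ 2 ≤ (2 * K ^ 2) * Fintype.card (Fin (m + 1)) := by
    rw [Finset.sum_comm]
    have hcol : ∀ b, ∑ a, ‖B a b‖ ^ 2 ≤ 2 * K ^ 2 := fun b => by
      rw [Fin.sum_univ_succ]
      -- each increment is at most `K`, and the increments of a column add up to at most `K`
      have h1 : ∀ a : Fin m, ‖B a.succ b‖ ^ 2 ≤ K * (Φ b a.succ - Φ b a.castSucc) := fun a => by
        have h2 := hv b a
        have h3 : Φ b a.succ - Φ b a.castSucc ≤ K := by linarith [hΦ0 b a.castSucc, hΦK b a.succ]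
        have h4 : B a.succ b = A a.succ b - A a.castSucc b := by simp [hB]
        rw [h4, sq]
        exact mul_le_mul (h2.trans h3) h2 (norm_nonneg _) hK.le
      have h5 : ∑ a : Fin m, (Φ b a.succ - Φ b a.castSucc) = Φ b (Fin.last m) - Φ b 0 := by
        rw [Finset.sum_sub_distrib]
        linarith [Fin.sum_univ_succ (Φ b), Fin.sum_univ_castSucc (Φ b)]
      have h6 := Finset.sum_le_sum fun a (_ : a ∈ Finset.univ) => h1 a
      rw [← Finset.mul_sum, h5] at h6
      have h7 : ‖B 0 b‖ ^ 2 ≤ K ^ 2 := by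
        have : B 0 b = A 0 b := by simp [hB]
        rw [this]
        gcongr
        exact hA 0 b
      nlinarith [hΦ0 b 0, hΦK b (Fin.last m)]
    refine (Finset.sum_le_sum fun b _ => hcol b).trans ?_
    simp [mul_comm]
  rw [hdet]
  simpa using norm_det_sq_le B (by positivity) hF

/-- If the rows of a matrix carry keys in a linear order, along which every column has variation
bounded by a potential `Φ` with values in `[0, K]`, then its determinant grows at most exponentially
in its size. Subtracting from each row its predecessor leaves the determinant unchanged and makes
the Frobenius norm of each column `O(1)`. -/
lemma norm_det_sq_le_of_variation {ι α : Type*} [Fintype ι] [DecidableEq ι] [LinearOrder α]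
    (A : Matrix ι ι ℂ) (κ : ι → α) (Φ : ι → α → ℝ) {K : ℝ} (hK : 0 < K)
    (hA : ∀ a b, ‖A a b‖ ≤ K) (hΦ0 : ∀ b a, 0 ≤ Φ b (κ a)) (hΦK : ∀ b a, Φ b (κ a) ≤ K)
    (hv : ∀ b a a', κ a ≤ κ a' → ‖A a' b - A a b‖ ≤ Φ b (κ a') - Φ b (κ a)) :
    ‖A.det‖ ^ 2 ≤ (2 * K ^ 2) ^ Fintype.card ι := by
  obtain hm | ⟨m, hm⟩ : Fintype.card ι = 0 ∨ ∃ m, Fintype.card ι = m + 1 := by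
    cases h : Fintype.card ι <;> simp
  · have := Fintype.card_eq_zero_iff.1 hm
    simp
  · let e : Fin (m + 1) ≃ ι := (Fintype.equivFinOfCardEq hm).symm
    let s : Fin (m + 1) ≃ ι := (Tuple.sort (κ ∘ e)).trans e
    have hs : Monotone (κ ∘ s) := Tuple.monotone_sort (κ ∘ e)
    rw [hm, ← Matrix.det_submatrix_equiv_self s A]
    refine norm_det_sq_le_of_monotone _ (fun b a => Φ (s b) (κ (s a))) hK
      (fun a b => hA _ _) (fun b a => hΦ0 _ _) (fun b a => hΦK _ _) fun b a => ?_
    exact hv _ _ _ (hs (Fin.castSucc_le_succ a))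

/-! ### The covariance as a function of the time of its first argument -/

/-- The time dependent factor of the covariance for a mode of energy `E`, as a function of the time
difference `u = y - x`. -/
noncomputable def propagator (β E u : ℝ) : ℝ :=
  Real.exp (-u * E) *
    ((if u ≤ 0 then 1 else 0) / (1 + Real.exp (β * E))
      - (if 0 < u then 1 else 0) / (1 + Real.exp (-(β * E))))

lemma covariance_eq {d L : ℕ} [NeZero L] (β t t' μ : ℝ)
    (X : Site d L) (σ : Spin) (x : ℝ) (Y : Site d L) (τ : Spin) (y : ℝ) :
    covariance β t t' μ X σ x Y τ y = delta σ τ / (L : ℂ) ^ d *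
      ∑ p : Fin d → ZMod L, Complex.exp (Complex.I * (pairing p (Y - X) : ℂ)) *
        (propagator β (dispersion t t' μ p) (y - x) : ℂ) := rfl

lemma exp_sub_exp_le (a b : ℝ) : Real.exp a - Real.exp b ≤ Real.exp a * (a - b) := by
  have h := Real.add_one_le_exp (b - a)
  have h2 : Real.exp b = Real.exp a * Real.exp (b - a) := by rw [← Real.exp_add]; congr 1; ring
  rw [h2]
  nlinarith [Real.exp_pos a]

lemma neg_mul_le_mul_of_abs_le {β E E₀ u : ℝ} (hE : |E| ≤ E₀) (hu : |u| ≤ β) :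
    -u * E ≤ β * E₀ := by
  calc -u * E ≤ |-u * E| := le_abs_self _
    _ = |u| * |E| := by rw [abs_mul, abs_neg]
    _ ≤ β * E₀ := mul_le_mul hu hE (abs_nonneg _) ((abs_nonneg _).trans hu)

lemma abs_exp_sub_exp_le {β E E₀ u v : ℝ} (hE : |E| ≤ E₀) (hu : |u| ≤ β) (hv : |v| ≤ β)
    (huv : v ≤ u) :
    |Real.exp (-v * E) - Real.exp (-u * E)| ≤ E₀ * Real.exp (β * E₀) * (u - v) := by
  have h1 := exp_sub_exp_le (-v * E) (-u * E)
  have h2 := exp_sub_exp_le (-u * E) (-v * E)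
  have h3 := Real.exp_le_exp.2 (neg_mul_le_mul_of_abs_le hE hu)
  have h4 := Real.exp_le_exp.2 (neg_mul_le_mul_of_abs_le hE hv)
  have h5 := abs_le.1 hE
  have key : ∀ a b : ℝ, 0 < a → a ≤ b → ∀ c : ℝ, |c| ≤ E₀ → a * (c * (u - v)) ≤
      E₀ * b * (u - v) := fun a b ha hab c hc => by
    have h6 : a * c ≤ b * E₀ :=
      (mul_le_mul_of_nonneg_left ((le_abs_self c).trans hc) ha.le).trans
        (mul_le_mul_of_nonneg_right hab ((abs_nonneg c).trans hc))
    nlinarith [mul_le_mul_of_nonneg_right h6 (sub_nonneg.2 huv)]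
  rw [abs_le]
  constructor
  · have := key _ _ (Real.exp_pos (-u * E)) h3 (-E) (by rwa [abs_neg])
    nlinarith
  · have := key _ _ (Real.exp_pos (-v * E)) h4 E hE
    nlinarith

lemma inv_one_add_exp_mem (a : ℝ) : 0 ≤ 1 / (1 + Real.exp a) ∧ 1 / (1 + Real.exp a) ≤ 1 := by
  have := Real.exp_pos a
  refine ⟨by positivity, ?_⟩
  rw [div_le_one (by positivity)]
  linarith

lemma propagator_of_nonpos {β E u : ℝ} (hu : u ≤ 0) :
    propagator β E u = Real.exp (-u * E) * (1 / (1 + Real.exp (β * E))) := by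
  simp [propagator, hu, not_lt.2 hu]

lemma propagator_of_pos {β E u : ℝ} (hu : 0 < u) :
    propagator β E u = -(Real.exp (-u * E) * (1 / (1 + Real.exp (-(β * E))))) := by
  simp [propagator, hu, not_le.2 hu]

lemma abs_propagator_le {β E E₀ u : ℝ} (hE : |E| ≤ E₀) (hu : |u| ≤ β) :
    |propagator β E u| ≤ Real.exp (β * E₀) := by
  have h1 := Real.exp_le_exp.2 (neg_mul_le_mul_of_abs_le hE hu)
  have key : ∀ a : ℝ, |Real.exp (-u * E) * (1 / (1 + Real.exp a))| ≤ Real.exp (β * E₀) :=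
    fun a => by
      obtain ⟨h2, h3⟩ := inv_one_add_exp_mem a
      rw [abs_of_nonneg (by positivity)]
      exact (mul_le_of_le_one_right (Real.exp_pos _).le h3).trans h1
  rcases le_or_gt u 0 with h | h
  · rw [propagator_of_nonpos h]
    exact key _
  · rw [propagator_of_pos h, abs_neg]
    exact key _

/-- The propagator is Lipschitz up to a single jump at `u = 0`. -/
lemma abs_propagator_sub_le {β E E₀ u v : ℝ} (hE : |E| ≤ E₀) (hu : |u| ≤ β) (hv : |v| ≤ β)
    (huv : v ≤ u) :
    |propagator β E v - propagator β E u| ≤ E₀ * Real.exp (β * E₀) * (u - v) +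
      2 * Real.exp (β * E₀) * ((if v ≤ 0 then 1 else 0) - (if u ≤ 0 then 1 else 0)) := by
  have hl := abs_exp_sub_exp_le hE hu hv huv
  have hE0 : 0 ≤ E₀ := (abs_nonneg _).trans hE
  have key : ∀ a : ℝ, |(Real.exp (-v * E) - Real.exp (-u * E)) * (1 / (1 + Real.exp a))| ≤
      E₀ * Real.exp (β * E₀) * (u - v) := fun a => by
    obtain ⟨h2, h3⟩ := inv_one_add_exp_mem a
    rw [abs_mul, abs_of_nonneg h2]
    exact (mul_le_of_le_one_right (abs_nonneg _) h3).trans hl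
  rcases le_or_gt u 0 with h | h
  · rw [propagator_of_nonpos h, propagator_of_nonpos (huv.trans h), ← sub_mul]
    simpa [h, huv.trans h] using key (β * E)
  · rcases le_or_gt v 0 with h' | h'
    · have h1 := abs_propagator_le hE hu
      have h2 := abs_propagator_le hE hv
      have h3 : 0 ≤ E₀ * Real.exp (β * E₀) * (u - v) := (abs_nonneg _).trans hl
      have h4 := abs_sub (propagator β E v) (propagator β E u)
      simp only [h', not_le.2 h, if_true, if_false]
      linarith
    · rw [propagator_of_pos h, propagator_of_pos h', ← abs_neg]
      have := key (-(β * E))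
      simp only [not_le.2 h, not_le.2 h', if_false, sub_self, mul_zero, add_zero]
      convert this using 2
      ring

lemma norm_delta_le {S : Type*} [DecidableEq S] (a b : S) : ‖delta a b‖ ≤ 1 := by
  unfold delta
  split_ifs <;> simp

/-- An average over momenta of unimodular phases times real numbers in `[-R, R]`. -/
lemma norm_delta_mul_sum_phase_le {d L : ℕ} [NeZero L] (σ τ : Spin) (θ r : (Fin d → ZMod L) → ℝ)
    {R : ℝ} (hr : ∀ p, |r p| ≤ R) :
    ‖delta σ τ / (L : ℂ) ^ d * ∑ p, Complex.exp (Complex.I * (θ p : ℂ)) * (r p : ℂ)‖ ≤ R := by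
  have hL : (0 : ℝ) < (L : ℝ) ^ d := by
    have := NeZero.pos L
    positivity
  have h1 : ‖∑ p, Complex.exp (Complex.I * (θ p : ℂ)) * (r p : ℂ)‖ ≤ (L : ℝ) ^ d * R := by
    refine (norm_sum_le _ _).trans ?_
    have : ∀ p, ‖Complex.exp (Complex.I * (θ p : ℂ)) * (r p : ℂ)‖ ≤ R := fun p => by
      rw [norm_mul, mul_comm Complex.I, Complex.norm_exp_ofReal_mul_I, one_mul,
        Complex.norm_real]
      exact hr p
    refine (Finset.sum_le_sum fun p _ => this p).trans ?_
    simp [ZMod.card]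
  rw [norm_mul, norm_div, norm_pow, Complex.norm_natCast, div_mul_eq_mul_div, div_le_iff₀ hL]
  calc ‖delta σ τ‖ * _ ≤ 1 * ((L : ℝ) ^ d * R) :=
        mul_le_mul (norm_delta_le σ τ) h1 (norm_nonneg _) zero_le_one
    _ = R * (L : ℝ) ^ d := by ring

section Bounds

variable {d L : ℕ} [NeZero L] {β t t' μ E₀ : ℝ}

lemma norm_covariance_le (hE : ∀ p : Fin d → ZMod L, |dispersion t t' μ p| ≤ E₀)
    (X : Site d L) (σ : Spin) (Y : Site d L) (τ : Spin) {x y : ℝ} (hx : x ∈ Set.Icc 0 β)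
    (hy : y ∈ Set.Icc 0 β) :
    ‖covariance β t t' μ X σ x Y τ y‖ ≤ Real.exp (β * E₀) := by
  rw [covariance_eq]
  refine norm_delta_mul_sum_phase_le _ _ _ _ fun p => abs_propagator_le (hE p) ?_
  rw [abs_le]
  constructor <;> linarith [hx.1, hx.2, hy.1, hy.2]

/-- As a function of the time `x` of its first argument, the covariance is Lipschitz up to a single
jump at `x = y`. -/
lemma norm_covariance_sub_le (hE : ∀ p : Fin d → ZMod L, |dispersion t t' μ p| ≤ E₀)
    (X : Site d L) (σ : Spin) (Y : Site d L) (τ : Spin) {x x' y : ℝ} (hx : x ∈ Set.Icc 0 β)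
    (hx' : x' ∈ Set.Icc 0 β) (hy : y ∈ Set.Icc 0 β) (hxx : x ≤ x') :
    ‖covariance β t t' μ X σ x' Y τ y - covariance β t t' μ X σ x Y τ y‖ ≤
      E₀ * Real.exp (β * E₀) * (x' - x) +
        2 * Real.exp (β * E₀) * ((if y ≤ x' then 1 else 0) - (if y ≤ x then 1 else 0)) := by
  rw [covariance_eq, covariance_eq, ← mul_sub, ← Finset.sum_sub_distrib]
  simp_rw [← mul_sub, ← Complex.ofReal_sub]
  refine norm_delta_mul_sum_phase_le _ _ _ _ fun p => ?_
  have h := abs_propagator_sub_le (β := β) (u := y - x) (v := y - x') (hE p)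
    (by rw [abs_le]; constructor <;> linarith [hx.1, hx.2, hy.1, hy.2])
    (by rw [abs_le]; constructor <;> linarith [hx'.1, hx'.2, hy.1, hy.2]) (by linarith)
  simp only [sub_nonpos] at h
  convert h using 3
  ring

end Bounds

/-- The determinant bound: at times in `[0, β]`, the determinant of order `2n` is at most `K ^ n`
with `K` independent of all the arguments. The rows are ordered by site and spin first and by time
second; since there are finitely many sites and spins, every column has bounded variation. -/
lemma exists_norm_covDet_le (d L : ℕ) [NeZero L] (β t t' μ : ℝ) (hβ : 0 < β) :
    ∃ K : ℝ, 0 < K ∧ ∀ (n : ℕ) (X Y : Idx n → Site d L) (σ : Idx n → Spin) (x : Idx n → ℝ),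
      (∀ a, x a ∈ Set.Icc 0 β) → ‖covDet β t t' μ X Y σ x‖ ≤ K ^ n := by
  obtain ⟨E₀, hE0, hE⟩ : ∃ E₀ : ℝ, 0 ≤ E₀ ∧
      ∀ p : Fin d → ZMod L, |dispersion t t' μ p| ≤ E₀ :=
    ⟨∑ p : Fin d → ZMod L, |dispersion t t' μ p|, Finset.sum_nonneg fun _ _ => abs_nonneg _,
      fun p => Finset.single_le_sum (f := fun p : Fin d → ZMod L => |dispersion t t' μ p|)
        (fun _ _ => abs_nonneg _) (Finset.mem_univ p)⟩
  set D : ℝ := Real.exp (β * E₀) with hD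
  have hD0 : 0 < D := Real.exp_pos _
  let e := Fintype.equivFin (Site d L × Spin)
  set N : ℕ := Fintype.card (Site d L × Spin)
  -- `W` is the sum of the bound `2 * D` on a change of site and spin and of the variation
  -- `E₀ * D * β + 2 * D` in time at a fixed site and spin
  set W : ℝ := 4 * D + E₀ * D * β with hW
  have hW0 : 0 < W := by positivity
  set K : ℝ := W * N + W with hK
  have hK0 : 0 < K := by positivity
  refine ⟨2 * K ^ 2, by positivity, fun n X Y σ x hx => ?_⟩
  obtain ⟨step, hstep⟩ : ∃ step : ℝ → ℝ → ℝ, ∀ a b, step a b = if a ≤ b then 1 else 0 :=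
    ⟨_, fun _ _ => rfl⟩
  have h01 : ∀ a b : ℝ, 0 ≤ step a b ∧ step a b ≤ 1 := fun a b => by
    rw [hstep]
    split_ifs <;> simp
  have hED : 0 ≤ E₀ * D := by positivity
  have hr : ∀ a, 0 ≤ E₀ * D * x a ∧ E₀ * D * x a ≤ E₀ * D * β := fun a =>
    ⟨mul_nonneg hED (hx a).1, mul_le_mul_of_nonneg_left (hx a).2 hED⟩
  have hmain := norm_det_sq_le_of_variation
    (Matrix.of fun a b : Idx n =>
      covariance β t t' μ (X a) (σ a) (x a) (Y b) (σ b) (x b))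
    (fun a => toLex (e (X a, σ a), x a))
    (fun b k => W * ((ofLex k).1 : ℕ) + E₀ * D * (ofLex k).2 +
      2 * D * step (x b) (ofLex k).2) hK0 ?_ ?_ ?_ ?_
  · rw [Fintype.card_prod, Fintype.card_fin, Fintype.card_fin, pow_mul] at hmain
    rw [sq_le_sq₀ (norm_nonneg _) (by positivity)] at hmain
    exact hmain
  · intro a b
    refine (norm_covariance_le hE _ _ _ _ (hx a) (hx b)).trans ?_
    have : 0 ≤ W * N := by positivity
    have : 0 ≤ E₀ * D * β := by positivity
    rw [← hD]
    linarith
  · intro b a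
    have := (h01 (x b) (x a)).1
    have := (hr a).1
    simp only [ofLex_toLex]
    positivity
  · intro b a
    have h1 := (h01 (x b) (x a)).2
    have h2 := (hr a).2
    have h3 : W * ((e (X a, σ a) : ℕ) : ℝ) ≤ W * N := by
      gcongr
      exact (e (X a, σ a)).2.le
    simp only [ofLex_toLex]
    nlinarith
  · intro b a a' h
    rw [Prod.Lex.toLex_le_toLex] at h
    simp only [ofLex_toLex, Matrix.of_apply]
    rcases h with h | ⟨h, h'⟩
    · have h1 := norm_sub_le (covariance β t t' μ (X a') (σ a') (x a') (Y b) (σ b) (x b))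
        (covariance β t t' μ (X a) (σ a) (x a) (Y b) (σ b) (x b))
      have h2 := norm_covariance_le hE (X a) (σ a) (Y b) (σ b) (hx a) (hx b)
      have h3 := norm_covariance_le hE (X a') (σ a') (Y b) (σ b) (hx a') (hx b)
      have h4 : ((e (X a, σ a) : ℕ) : ℝ) + 1 ≤ ((e (X a', σ a') : ℕ) : ℝ) := by
        exact_mod_cast h
      have h5 : W * (((e (X a, σ a) : ℕ) : ℝ) + 1) ≤ W * ((e (X a', σ a') : ℕ) : ℝ) :=
        mul_le_mul_of_nonneg_left h4 hW0.le
      have h6 := mul_nonneg hD0.le (h01 (x b) (x a')).1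
      have h7 := mul_le_mul_of_nonneg_left (h01 (x b) (x a)).2 hD0.le
      have h8 := (hr a').1
      have h9 := (hr a).2
      rw [← hD] at h2 h3
      linarith
    · have h1 := e.injective h
      simp only [Prod.mk.injEq] at h1
      rw [← h1.1, ← h1.2]
      have h2 := norm_covariance_sub_le hE (X a) (σ a) (Y b) (σ b) (hx a) (hx a') (hx b) h'
      rw [← hD, ← hstep, ← hstep] at h2
      linarith

/-! ### Regularity of the determinants in the times -/

section Regularity

variable {d L : ℕ} [NeZero L] {β t t' μ : ℝ} {n : ℕ}

lemma measurable_propagator (β E : ℝ) : Measurable (propagator β E) := by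
  unfold propagator
  refine Measurable.mul (by fun_prop) (Measurable.sub (Measurable.div_const ?_ _)
    (Measurable.div_const ?_ _))
  · exact Measurable.ite measurableSet_Iic measurable_const measurable_const
  · exact Measurable.ite measurableSet_Ioi measurable_const measurable_const

lemma continuousAt_propagator {β E u : ℝ} (hu : u ≠ 0) : ContinuousAt (propagator β E) u := by
  rcases lt_or_gt_of_ne hu with h | h
  · have h1 : (fun u => Real.exp (-u * E) * (1 / (1 + Real.exp (β * E)))) =ᶠ[𝓝 u]
        propagator β E := by
      filter_upwards [Iio_mem_nhds h] with v hv using (propagator_of_nonpos (le_of_lt hv)).symm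
    exact ContinuousAt.congr (by fun_prop) h1
  · have h1 : (fun u => -(Real.exp (-u * E) * (1 / (1 + Real.exp (-(β * E)))))) =ᶠ[𝓝 u]
        propagator β E := by
      filter_upwards [Ioi_mem_nhds h] with v hv using (propagator_of_pos hv).symm
    exact ContinuousAt.congr (by fun_prop) h1

lemma measurable_covDet (X Y : Idx n → Site d L) (σ : Idx n → Spin) :
    Measurable fun s : Fin n → ℝ => covDet β t t' μ X Y σ (fun a => s a.1) := by
  unfold covDet
  simp_rw [Matrix.det_apply, Matrix.of_apply, covariance_eq]
  refine Finset.measurable_sum _ fun τ _ => Measurable.const_smul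
    (Finset.measurable_prod _ fun a _ => Measurable.const_mul
      (Finset.measurable_sum _ fun p _ => Measurable.const_mul ?_ _) _) _
  exact Complex.measurable_ofReal.comp ((measurable_propagator _ _).comp (by fun_prop))

/-- The determinant is continuous in the times wherever these are pairwise distinct. Entries whose
row and column belong to the same time are constant. -/
lemma tendsto_covDet (X Y : Idx n → Site d L) (σ : Idx n → Spin) {s : Fin n → ℝ}
    (hs : Function.Injective s) {φ : ℕ → Fin n → ℝ}
    (hφ : ∀ i, Tendsto (fun m => φ m i) atTop (𝓝 (s i))) :
    Tendsto (fun m => covDet β t t' μ X Y σ (fun a => φ m a.1)) atTop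
      (𝓝 (covDet β t t' μ X Y σ (fun a => s a.1))) := by
  unfold covDet
  simp_rw [Matrix.det_apply, Matrix.of_apply, covariance_eq]
  refine tendsto_finsetSum _ fun τ _ => Tendsto.const_smul
    (tendsto_finsetProd _ fun a _ => Tendsto.const_mul _
      (tendsto_finsetSum _ fun p _ => Tendsto.const_mul _ ?_)) _
  refine (Complex.continuous_ofReal.tendsto _).comp ?_
  by_cases h : a.1 = (τ a).1
  · simp [h]
  · have h1 : s a.1 - s (τ a).1 ≠ 0 := sub_ne_zero.2 (hs.ne h)
    exact (continuousAt_propagator h1).tendsto.comp ((hφ _).sub (hφ _))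

lemma integrableOn_covDet (hβ : 0 < β) (X Y : Idx n → Site d L) (σ : Idx n → Spin) :
    IntegrableOn (fun s : Fin n → ℝ => covDet β t t' μ X Y σ (fun a => s a.1))
      (Set.Icc (0 : Fin n → ℝ) (fun _ => β)) := by
  obtain ⟨K, hK, hb⟩ := exists_norm_covDet_le d L β t t' μ hβ
  refine Measure.integrableOn_of_bounded (M := K ^ n) isCompact_Icc.measure_ne_top
    (measurable_covDet X Y σ).aestronglyMeasurable ?_
  filter_upwards [ae_restrict_mem measurableSet_Icc] with s hs
  exact hb n X Y σ _ fun a => ⟨hs.1 a.1, hs.2 a.1⟩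

end Regularity

/-! ### Riemann sums over the time grid -/

/-- Almost every point of `ℝⁿ` has pairwise distinct coordinates. -/
lemma ae_injective (n : ℕ) : ∀ᵐ s : Fin n → ℝ, Function.Injective s := by
  have h : ∀ i j : Fin n, i ≠ j → ∀ᵐ s : Fin n → ℝ, s i ≠ s j := fun i j hij => by
    let V : Submodule ℝ (Fin n → ℝ) := LinearMap.ker
      (LinearMap.proj (R := ℝ) (φ := fun _ : Fin n => ℝ) i - LinearMap.proj j)
    have hV : V ≠ ⊤ := fun h => by
      have h1 : (Pi.single i 1 : Fin n → ℝ) ∈ V := h ▸ Submodule.mem_top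
      simp [V, hij.symm] at h1
    have h2 := Measure.addHaar_submodule (volume : Measure (Fin n → ℝ)) V hV
    rw [ae_iff]
    convert h2 using 2
    ext s
    simp [V, sub_eq_zero]
  have h1 : ∀ᵐ s : Fin n → ℝ, ∀ i j : Fin n, i ≠ j → s i ≠ s j := by
    simp_rw [ae_all_iff]
    exact fun i j hij => h i j hij
  filter_upwards [h1] with s hs i j hij
  by_contra h
  exact hs i j h hij

/-- Rounding down to the grid of spacing `β / m`. -/
noncomputable def gridFloor (β : ℝ) (m : ℕ) (x : ℝ) : ℝ :=
  (⌊x * ((m : ℝ) / β)⌋₊ : ℝ) / ((m : ℝ) / β)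

lemma measurable_gridFloor (β : ℝ) (m : ℕ) : Measurable (gridFloor β m) := by
  unfold gridFloor
  refine Measurable.div_const (measurable_from_nat.comp (Nat.measurable_floor.comp ?_)) _
  fun_prop

lemma gridFloor_mem_Icc {β : ℝ} (hβ : 0 < β) (m : ℕ) {x : ℝ} (hx : x ∈ Set.Icc 0 β) :
    gridFloor β m x ∈ Set.Icc 0 β := by
  rcases Nat.eq_zero_or_pos m with rfl | hm
  · simp [gridFloor, hβ.le]
  · have hh : (0 : ℝ) < (m : ℝ) / β := by positivity
    refine ⟨by unfold gridFloor; positivity, le_trans ?_ hx.2⟩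
    rw [gridFloor, div_le_iff₀ hh]
    exact Nat.floor_le (mul_nonneg hx.1 hh.le)

lemma tendsto_gridFloor {β : ℝ} (hβ : 0 < β) {x : ℝ} (hx : 0 ≤ x) :
    Tendsto (fun m => gridFloor β m x) atTop (𝓝 x) :=
  (tendsto_nat_floor_mul_div_atTop hx).comp
    (tendsto_natCast_atTop_atTop.atTop_div_const hβ)

lemma gridFloor_eq {β : ℝ} (hβ : 0 < β) {m : ℕ} (hm : 0 < m) {g x : ℝ} (hg : g ∈ timeGrid β m)
    (hx : x ∈ Set.Ico g (g + 1 / ((m : ℝ) / β))) : gridFloor β m x = g := by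
  have hh : (0 : ℝ) < (m : ℝ) / β := by positivity
  obtain ⟨l, -, rfl⟩ := Finset.mem_image.1 hg
  have h1 : ⌊x * ((m : ℝ) / β)⌋₊ = l := by
    have h2 := hx.1
    have h3 := hx.2
    rw [div_le_iff₀ hh] at h2
    rw [← add_div, lt_div_iff₀ hh] at h3
    rw [Nat.floor_eq_iff ((Nat.cast_nonneg l).trans h2)]
    exact ⟨h2, h3⟩
  rw [gridFloor, h1]

lemma timeGrid_bounds {β : ℝ} (hβ : 0 < β) {m : ℕ} (hm : 0 < m) {g : ℝ} (hg : g ∈ timeGrid β m) :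
    0 ≤ g ∧ g + 1 / ((m : ℝ) / β) ≤ β := by
  have hm' : (0 : ℝ) < m := by exact_mod_cast hm
  obtain ⟨l, hl, rfl⟩ := Finset.mem_image.1 hg
  have hl' : (l : ℝ) + 1 ≤ m := by exact_mod_cast Finset.mem_range.1 hl
  refine ⟨by positivity, ?_⟩
  rw [← add_div, div_le_iff₀ (by positivity)]
  calc (l : ℝ) + 1 ≤ m := hl'
    _ = β * (m / β) := by field_simp

lemma gridFloor_mem_timeGrid {β : ℝ} (hβ : 0 < β) {m : ℕ} (hm : 0 < m) {x : ℝ}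
    (hx : x ∈ Set.Ico 0 β) : gridFloor β m x ∈ timeGrid β m ∧
      x ∈ Set.Ico (gridFloor β m x) (gridFloor β m x + 1 / ((m : ℝ) / β)) := by
  have hm' : (0 : ℝ) < m := by exact_mod_cast hm
  have hh : (0 : ℝ) < (m : ℝ) / β := by positivity
  refine ⟨Finset.mem_image.2 ⟨_, Finset.mem_range.2 ?_, rfl⟩, ?_, ?_⟩
  · rw [Nat.floor_lt (mul_nonneg hx.1 hh.le)]
    calc x * (m / β) < β * (m / β) := mul_lt_mul_of_pos_right hx.2 hh
      _ = m := by field_simp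
  · rw [gridFloor, div_le_iff₀ hh]
    exact Nat.floor_le (mul_nonneg hx.1 hh.le)
  · rw [gridFloor, ← add_div, lt_div_iff₀ hh]
    exact Nat.lt_floor_add_one _

/-- A Riemann sum over the grid is the integral of the function rounded down to the grid. -/
lemma sum_timeGrid_eq_integral {n : ℕ} {β : ℝ} (hβ : 0 < β) {m : ℕ} (hm : 0 < m)
    (F : (Fin n → ℝ) → ℂ) :
    ∑ s ∈ Fintype.piFinset (fun _ : Fin n => timeGrid β m),
        (1 / ((m : ℂ) / (β : ℂ))) ^ n * F s =
      ∫ s in Set.Icc (0 : Fin n → ℝ) (fun _ => β), F (fun i => gridFloor β m (s i)) := by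
  have hm' : (0 : ℝ) < m := by exact_mod_cast hm
  have hh : (0 : ℝ) < 1 / ((m : ℝ) / β) := by positivity
  let cell : (Fin n → ℝ) → Set (Fin n → ℝ) :=
    fun g => Set.univ.pi fun i => Set.Ico (g i) (g i + 1 / ((m : ℝ) / β))
  have hcell : ∀ g ∈ Fintype.piFinset (fun _ : Fin n => timeGrid β m), ∀ s ∈ cell g,
      (fun i => gridFloor β m (s i)) = g := fun g hg s hs => funext fun i =>
    gridFloor_eq hβ hm (Fintype.mem_piFinset.1 hg i) (hs i (Set.mem_univ i))
  have hmeas : ∀ g, MeasurableSet (cell g) := fun g =>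
    MeasurableSet.univ_pi fun i => measurableSet_Ico
  have hvol : ∀ g, volume.real (cell g) = (1 / ((m : ℝ) / β)) ^ n := fun g => by
    rw [Measure.real, volume_pi_pi]
    simp [ENNReal.toReal_ofReal, hβ.le, div_nonneg]
  have hunion : Set.univ.pi (fun _ : Fin n => Set.Ico 0 β) =
      ⋃ g ∈ Fintype.piFinset (fun _ : Fin n => timeGrid β m), cell g := by
    ext s
    simp only [Set.mem_iUnion, exists_prop]
    constructor
    · intro hs
      exact ⟨fun i => gridFloor β m (s i),
        Fintype.mem_piFinset.2 fun i => (gridFloor_mem_timeGrid hβ hm (hs i (Set.mem_univ i))).1,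
        fun i _ => (gridFloor_mem_timeGrid hβ hm (hs i (Set.mem_univ i))).2⟩
    · rintro ⟨g, hg, hs⟩ i -
      have h1 := timeGrid_bounds hβ hm (Fintype.mem_piFinset.1 hg i)
      have h2 := hs i (Set.mem_univ i)
      exact ⟨h1.1.trans h2.1, h2.2.trans_le h1.2⟩
  have hae : Set.univ.pi (fun _ : Fin n => Set.Ico 0 β) =ᵐ[volume]
      Set.Icc (0 : Fin n → ℝ) (fun _ => β) := Measure.univ_pi_Ico_ae_eq_Icc
  have hconst : ∀ g ∈ Fintype.piFinset (fun _ : Fin n => timeGrid β m),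
      Set.EqOn (fun s : Fin n → ℝ => F (fun i => gridFloor β m (s i))) (fun _ => F g) (cell g) :=
    fun g hg s hs => congrArg F (hcell g hg s hs)
  rw [← setIntegral_congr_set hae, hunion, integral_biUnion_finset]
  · refine Finset.sum_congr rfl fun g hg => ?_
    rw [setIntegral_congr_fun (hmeas g) (hconst g hg), setIntegral_const, hvol]
    simp
  · exact fun g _ => hmeas g
  · intro g hg g' hg' hne
    refine Set.disjoint_left.2 fun s hs hs' => hne ?_
    rw [← hcell g hg s hs, ← hcell g' hg' s hs']
  · intro g hg
    rw [integrableOn_congr_fun (hconst g hg) (hmeas g)]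
    refine integrableOn_const ?_
    simp only [cell]
    rw [volume_pi_pi]
    exact ENNReal.prod_ne_top fun i _ => by simp

/-! ### Convergence of the single orders and of the series -/

section Orders

variable {d L : ℕ}

/-- The product of the couplings in a term of order `n`. -/
noncomputable def couplingProd {n : ℕ} (U : Coupling d L) (X Y : Idx n → Site d L)
    (σ : Idx n → Spin) : ℂ :=
  ∏ j : Fin n, -(delta (σ (j, 0)) Spin.up * delta (σ (j, 1)) Spin.down *
    U (X (j, 0), X (j, 1), Y (j, 0), Y (j, 1)))

lemma norm_couplingProd_le {n : ℕ} {U : Coupling d L} {r : ℝ} (hU : ∀ 𝒳, ‖U 𝒳‖ ≤ r)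
    (X Y : Idx n → Site d L) (σ : Idx n → Spin) : ‖couplingProd U X Y σ‖ ≤ r ^ n := by
  have h : ∀ j : Fin n, ‖-(delta (σ (j, 0)) Spin.up * delta (σ (j, 1)) Spin.down *
      U (X (j, 0), X (j, 1), Y (j, 0), Y (j, 1)))‖ ≤ r := fun j => by
    rw [norm_neg, norm_mul, norm_mul]
    refine (mul_le_of_le_one_left (norm_nonneg _) ?_).trans (hU _)
    exact mul_le_one₀ (norm_delta_le _ _) (norm_nonneg _) (norm_delta_le _ _)
  unfold couplingProd
  rw [norm_prod]
  calc _ ≤ ∏ _j : Fin n, r := Finset.prod_le_prod (fun _ _ => norm_nonneg _) fun j _ => h j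
    _ = r ^ n := by simp

variable [NeZero L]

/-- The term of order `n` obtained when the time integral of each determinant is replaced by
`Z X Y σ`. -/
noncomputable def orderTerm {n : ℕ} (U : Coupling d L)
    (Z : (Idx n → Site d L) → (Idx n → Site d L) → (Idx n → Spin) → ℂ) : ℂ :=
  (1 / (n.factorial : ℂ)) *
    ∑ X : Idx n → Site d L, ∑ Y : Idx n → Site d L, ∑ σ : Idx n → Spin,
      couplingProd U X Y σ * Z X Y σ

/-- The majorant of `orderTerm U Z` over the polydisc of radius `r`. -/
noncomputable def orderBound {n : ℕ} (r : ℝ)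
    (Z : (Idx n → Site d L) → (Idx n → Site d L) → (Idx n → Spin) → ℂ) : ℝ :=
  (1 / (n.factorial : ℝ)) *
    ∑ X : Idx n → Site d L, ∑ Y : Idx n → Site d L, ∑ σ : Idx n → Spin, r ^ n * ‖Z X Y σ‖

lemma norm_orderTerm_le {n : ℕ} {U : Coupling d L} {r : ℝ} (hU : ∀ 𝒳, ‖U 𝒳‖ ≤ r)
    (Z : (Idx n → Site d L) → (Idx n → Site d L) → (Idx n → Spin) → ℂ) :
    ‖orderTerm U Z‖ ≤ orderBound r Z := by
  unfold orderTerm orderBound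
  rw [norm_mul, norm_div, norm_one, Complex.norm_natCast]
  refine mul_le_mul_of_nonneg_left ?_ (by positivity)
  refine norm_sum_le_of_le _ fun X _ => norm_sum_le_of_le _ fun Y _ =>
    norm_sum_le_of_le _ fun σ _ => ?_
  rw [norm_mul]
  exact mul_le_mul_of_nonneg_right (norm_couplingProd_le hU X Y σ) (norm_nonneg _)

lemma orderTerm_sub {n : ℕ} (U : Coupling d L)
    (Z Z' : (Idx n → Site d L) → (Idx n → Site d L) → (Idx n → Spin) → ℂ) :
    orderTerm U (fun X Y σ => Z X Y σ - Z' X Y σ) = orderTerm U Z - orderTerm U Z' := by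
  simp only [orderTerm, mul_sub, Finset.sum_sub_distrib]

/-- The number of configurations per order, `4 * |Γ| ^ 4`: four sites and two spins. -/
noncomputable def configCount (d L : ℕ) [NeZero L] : ℝ := 4 * (Fintype.card (Site d L) : ℝ) ^ 4

lemma orderBound_le {n : ℕ} {r : ℝ} (hr : 0 ≤ r)
    {Z : (Idx n → Site d L) → (Idx n → Site d L) → (Idx n → Spin) → ℂ} {c : ℝ}
    (hZ : ∀ X Y σ, ‖Z X Y σ‖ ≤ c) :
    orderBound r Z ≤ (configCount d L * r) ^ n / n.factorial * c := by
  have h1 : orderBound r Z ≤ (1 / (n.factorial : ℝ)) *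
      ∑ _X : Idx n → Site d L, ∑ _Y : Idx n → Site d L, ∑ _σ : Idx n → Spin, r ^ n * c := by
    unfold orderBound
    gcongr
    exact hZ _ _ _
  refine h1.trans (le_of_eq ?_)
  have h2 : Fintype.card Spin = 2 := rfl
  simp only [Finset.sum_const, Finset.card_univ, Fintype.card_fun, Fintype.card_prod,
    Fintype.card_fin, h2, nsmul_eq_mul, configCount, Nat.cast_pow]
  have h3 : (((2 : ℕ) : ℝ) ^ (n * 2)) = 4 ^ n := by
    rw [mul_comm, pow_mul]
    norm_num
  rw [h3, mul_pow, mul_pow, ← pow_mul]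
  ring

end Orders

section TimeIntegrals

lemma norm_setIntegral_Icc_le {β : ℝ} (hβ : 0 < β) {n : ℕ} {f : (Fin n → ℝ) → ℂ} {c : ℝ}
    (hf : ∀ s ∈ Set.Icc (0 : Fin n → ℝ) (fun _ => β), ‖f s‖ ≤ c) :
    ‖∫ s in Set.Icc (0 : Fin n → ℝ) (fun _ => β), f s‖ ≤ c * β ^ n := by
  have h := norm_setIntegral_le_of_norm_le_const (μ := volume)
    (isCompact_Icc (a := (0 : Fin n → ℝ)) (b := fun _ => β)).measure_lt_top hf
  have h1 : volume.real (Set.Icc (0 : Fin n → ℝ) (fun _ => β)) = β ^ n := by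
    rw [Measure.real, Real.volume_Icc_pi]
    simp [ENNReal.toReal_ofReal, hβ.le]
  rwa [h1] at h

/-- Rounding the times down to the grid does not matter in the limit for a bounded measurable
function that is continuous at the points with pairwise distinct coordinates. -/
lemma tendsto_setIntegral_gridFloor {β : ℝ} (hβ : 0 < β) {n : ℕ} {F : (Fin n → ℝ) → ℂ} {c : ℝ}
    (hF : Measurable F) (hc : ∀ s ∈ Set.Icc (0 : Fin n → ℝ) (fun _ => β), ‖F s‖ ≤ c)
    (hlim : ∀ s : Fin n → ℝ, Function.Injective s → ∀ φ : ℕ → Fin n → ℝ,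
      (∀ i, Tendsto (fun m => φ m i) atTop (𝓝 (s i))) →
        Tendsto (fun m => F (φ m)) atTop (𝓝 (F s))) :
    Tendsto (fun m => ∫ s in Set.Icc (0 : Fin n → ℝ) (fun _ => β),
      F (fun i => gridFloor β m (s i))) atTop
      (𝓝 (∫ s in Set.Icc (0 : Fin n → ℝ) (fun _ => β), F s)) := by
  refine tendsto_integral_of_dominated_convergence (fun _ => c) (fun m => ?_)
    ?_ (fun m => ?_) ?_
  · have h : Measurable fun s : Fin n → ℝ => fun i => gridFloor β m (s i) := by
      refine measurable_pi_iff.2 fun i => ?_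
      have hi : Measurable fun s : Fin n → ℝ => s i := measurable_pi_apply i
      exact (measurable_gridFloor β m).comp hi
    exact (hF.comp h).aestronglyMeasurable
  · exact integrableOn_const (isCompact_Icc (a := (0 : Fin n → ℝ))).measure_ne_top
  · filter_upwards [ae_restrict_mem measurableSet_Icc] with s hs
    have h := fun i => gridFloor_mem_Icc hβ m ⟨hs.1 i, hs.2 i⟩
    exact hc _ ⟨fun i => (h i).1, fun i => (h i).2⟩
  · filter_upwards [ae_restrict_mem measurableSet_Icc, ae_restrict_of_ae (ae_injective n)]
      with s hs hinj
    exact hlim s hinj _ fun i => tendsto_gridFloor hβ (hs.1 i)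

end TimeIntegrals

section Convergence

variable {d L : ℕ} [NeZero L] (β t t' μ : ℝ)

/-- The time integral of the determinant of order `n`. -/
noncomputable def detIntegral {n : ℕ} (X Y : Idx n → Site d L) (σ : Idx n → Spin) : ℂ :=
  ∫ s in Set.Icc (0 : Fin n → ℝ) (fun _ => β), covDet β t t' μ X Y σ (fun a => s a.1)

/-- The Riemann sum of the determinant of order `n` over the time grid. -/
noncomputable def detRiemannSum (m : ℕ) {n : ℕ} (X Y : Idx n → Site d L) (σ : Idx n → Spin) : ℂ :=
  ∑ s ∈ Fintype.piFinset (fun _ : Fin n => timeGrid β m),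
    (1 / ((m : ℂ) / (β : ℂ))) ^ n * covDet β t t' μ X Y σ (fun a => s a.1)

lemma seriesTerm_eq (U : Coupling d L) (n : ℕ) :
    seriesTerm β t t' μ U n = orderTerm U (detIntegral β t t' μ (n := n)) := rfl

/-- The factors `δ_{x_{2j-1}, x_{2j}}` restrict the sum over `2n` times to a sum over `n` times. -/
lemma discreteTerm_eq (m : ℕ) (U : Coupling d L) (n : ℕ) :
    discreteTerm β t t' μ m U n = orderTerm U (detRiemannSum β t t' μ m (n := n)) := by
  unfold discreteTerm orderTerm
  refine congrArg _ ?_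
  refine Finset.sum_congr rfl fun X _ => Finset.sum_congr rfl fun Y _ =>
    Finset.sum_congr rfl fun σ _ => ?_
  rw [detRiemannSum, Finset.mul_sum]
  symm
  refine Finset.sum_of_injOn (fun s a => s a.1) ?_ ?_ ?_ ?_
  · intro s _ s' _ h
    funext i
    exact congrFun h (i, 0)
  · intro s hs
    simp only [Finset.mem_coe, Fintype.mem_piFinset] at hs ⊢
    exact fun a => hs a.1
  · intro x hx hx'
    obtain ⟨j, hj⟩ : ∃ j : Fin n, x (j, 0) ≠ x (j, 1) := by
      by_contra! h
      refine hx' ⟨fun i => x (i, 0), ?_, ?_⟩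
      · simp only [Finset.mem_coe, Fintype.mem_piFinset] at hx ⊢
        exact fun i => hx (i, 0)
      · funext ⟨i, k⟩
        fin_cases k
        · rfl
        · exact h i
    rw [Finset.prod_eq_zero (Finset.mem_univ j) (by simp [delta, hj]), zero_mul]
  · intro s _
    have h : ∏ j : Fin n, -(1 / ((m : ℂ) / (β : ℂ)) *
        (delta (σ (j, 0)) Spin.up * delta (σ (j, 1)) Spin.down * delta (s j) (s j) *
          U (X (j, 0), X (j, 1), Y (j, 0), Y (j, 1)))) =
        (1 / ((m : ℂ) / (β : ℂ))) ^ n * couplingProd U X Y σ := by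
      have h1 : (1 / ((m : ℂ) / (β : ℂ))) ^ n = ∏ _j : Fin n, (1 / ((m : ℂ) / (β : ℂ))) :=
        (Fin.prod_const n _).symm
      rw [h1, couplingProd, ← Finset.prod_mul_distrib]
      refine Finset.prod_congr rfl fun j _ => ?_
      simp [delta]
    rw [h]
    ring

variable {β t t' μ}

lemma detRiemannSum_eq (hβ : 0 < β) {m : ℕ} (hm : 0 < m) {n : ℕ} (X Y : Idx n → Site d L)
    (σ : Idx n → Spin) : detRiemannSum β t t' μ m X Y σ =
      ∫ s in Set.Icc (0 : Fin n → ℝ) (fun _ => β),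
        covDet β t t' μ X Y σ (fun a => gridFloor β m (s a.1)) :=
  sum_timeGrid_eq_integral hβ hm fun s => covDet β t t' μ X Y σ (fun a => s a.1)

lemma tendsto_detRiemannSum (hβ : 0 < β) {n : ℕ} (X Y : Idx n → Site d L) (σ : Idx n → Spin) :
    Tendsto (fun m => detRiemannSum β t t' μ m X Y σ) atTop (𝓝 (detIntegral β t t' μ X Y σ)) := by
  obtain ⟨K, hK, hb⟩ := exists_norm_covDet_le d L β t t' μ hβ
  have h := tendsto_setIntegral_gridFloor hβ (measurable_covDet (β := β) (t := t) (t' := t')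
    (μ := μ) X Y σ) (fun s hs => hb n X Y σ _ fun a => ⟨hs.1 a.1, hs.2 a.1⟩)
    fun s hs φ hφ => tendsto_covDet X Y σ hs hφ
  refine h.congr' ?_
  filter_upwards [eventually_gt_atTop 0] with m hm using (detRiemannSum_eq hβ hm X Y σ).symm

lemma norm_detIntegral_le (hβ : 0 < β) {K : ℝ} {n : ℕ}
    (hb : ∀ (X Y : Idx n → Site d L) (σ : Idx n → Spin) (x : Idx n → ℝ),
      (∀ a, x a ∈ Set.Icc 0 β) → ‖covDet β t t' μ X Y σ x‖ ≤ K ^ n)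
    (X Y : Idx n → Site d L) (σ : Idx n → Spin) :
    ‖detIntegral β t t' μ X Y σ‖ ≤ (K * β) ^ n := by
  rw [mul_pow]
  exact norm_setIntegral_Icc_le hβ fun s hs => hb X Y σ _ fun a => ⟨hs.1 a.1, hs.2 a.1⟩

lemma norm_detRiemannSum_le (hβ : 0 < β) {K : ℝ} {n m : ℕ} (hm : 0 < m)
    (hb : ∀ (X Y : Idx n → Site d L) (σ : Idx n → Spin) (x : Idx n → ℝ),
      (∀ a, x a ∈ Set.Icc 0 β) → ‖covDet β t t' μ X Y σ x‖ ≤ K ^ n)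
    (X Y : Idx n → Site d L) (σ : Idx n → Spin) :
    ‖detRiemannSum β t t' μ m X Y σ‖ ≤ (K * β) ^ n := by
  rw [mul_pow, detRiemannSum_eq hβ hm]
  exact norm_setIntegral_Icc_le hβ fun s hs => hb X Y σ _ fun a =>
    gridFloor_mem_Icc hβ m ⟨hs.1 a.1, hs.2 a.1⟩

lemma summable_norm_seriesTerm (hβ : 0 < β) (U : Coupling d L) :
    Summable fun n : ℕ => ‖seriesTerm β t t' μ U (n + 1)‖ := by
  obtain ⟨K, hK, hb⟩ := exists_norm_covDet_le d L β t t' μ hβ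
  set r : ℝ := ∑ 𝒳, ‖U 𝒳‖
  have hr : 0 ≤ r := Finset.sum_nonneg fun _ _ => norm_nonneg _
  have hU : ∀ 𝒳, ‖U 𝒳‖ ≤ r := fun 𝒳 =>
    Finset.single_le_sum (f := fun 𝒳 => ‖U 𝒳‖) (fun _ _ => norm_nonneg _) (Finset.mem_univ 𝒳)
  have hs := Real.summable_pow_div_factorial (configCount d L * r * (K * β))
  refine Summable.of_nonneg_of_le (fun _ => norm_nonneg _) (fun n => ?_)
    ((summable_nat_add_iff 1).2 hs)
  rw [seriesTerm_eq]
  refine (norm_orderTerm_le hU _).trans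
    ((orderBound_le hr (norm_detIntegral_le hβ (hb (n + 1)))).trans_eq ?_)
  rw [mul_pow _ (K * β)]
  ring

variable (β t t' μ) in
/-- The difference between the discretized and the exact time integral of the determinant of order
`n`, the former being dropped beyond the order `L ^ d * m` at which `P_h` is cut off. -/
noncomputable def detError (m n : ℕ) (X Y : Idx n → Site d L) (σ : Idx n → Spin) : ℂ :=
  (if n ≤ L ^ d * m then detRiemannSum β t t' μ m X Y σ else 0) - detIntegral β t t' μ X Y σ

lemma norm_detError_le (hβ : 0 < β) {K : ℝ} (hK : 0 < K) {n m : ℕ} (hm : 0 < m)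
    (hb : ∀ (X Y : Idx n → Site d L) (σ : Idx n → Spin) (x : Idx n → ℝ),
      (∀ a, x a ∈ Set.Icc 0 β) → ‖covDet β t t' μ X Y σ x‖ ≤ K ^ n)
    (X Y : Idx n → Site d L) (σ : Idx n → Spin) :
    ‖detError β t t' μ m n X Y σ‖ ≤ 2 * (K * β) ^ n := by
  have h1 := norm_detIntegral_le hβ hb X Y σ
  have h2 : ‖if n ≤ L ^ d * m then detRiemannSum β t t' μ m X Y σ else 0‖ ≤ (K * β) ^ n := by
    split_ifs
    · exact norm_detRiemannSum_le hβ hm hb X Y σ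
    · simpa using by positivity
  have h3 := norm_sub_le (if n ≤ L ^ d * m then detRiemannSum β t t' μ m X Y σ else 0)
    (detIntegral β t t' μ X Y σ)
  unfold detError
  linarith

lemma tendsto_orderBound_detError (hβ : 0 < β) (r : ℝ) (n : ℕ) :
    Tendsto (fun m => orderBound r (detError (d := d) (L := L) β t t' μ m n)) atTop (𝓝 0) := by
  have h : ∀ (X Y : Idx n → Site d L) (σ : Idx n → Spin),
      Tendsto (fun m => ‖detError β t t' μ m n X Y σ‖) atTop (𝓝 0) := fun X Y σ => by
    have h1 := ((tendsto_detRiemannSum (t := t) (t' := t') (μ := μ) hβ X Y σ).sub_const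
      (detIntegral β t t' μ X Y σ)).norm
    rw [sub_self, norm_zero] at h1
    refine h1.congr' ?_
    filter_upwards [eventually_ge_atTop n] with m hm
    have h2 : n ≤ L ^ d * m :=
      hm.trans (Nat.le_mul_of_pos_left m (pow_pos (NeZero.pos L) d))
    rw [detError, if_pos h2]
  have h0 : (0 : ℝ) = (1 / (n.factorial : ℝ)) * ∑ _X : Idx n → Site d L,
      ∑ _Y : Idx n → Site d L, ∑ _σ : Idx n → Spin, r ^ n * 0 := by simp
  rw [h0]
  exact Tendsto.const_mul _ (tendsto_finsetSum _ fun X _ => tendsto_finsetSum _ fun Y _ =>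
    tendsto_finsetSum _ fun σ _ => (h X Y σ).const_mul _)

lemma discretePartition_sub_partitionSeries (hβ : 0 < β) (m : ℕ) (U : Coupling d L) :
    discretePartition β t t' μ m U - partitionSeries β t t' μ U =
      ∑' n : ℕ, orderTerm U (detError β t t' μ m (n + 1)) := by
  have h1 : ∑ n ∈ Finset.Icc 1 (L ^ d * m), discreteTerm β t t' μ m U n =
      ∑ n ∈ Finset.range (L ^ d * m), discreteTerm β t t' μ m U (n + 1) := by
    rw [Finset.range_eq_Ico, Finset.sum_Ico_add' (fun n => discreteTerm β t t' μ m U n), zero_add]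
    rfl
  set f : ℕ → ℂ := fun n =>
    if n + 1 ≤ L ^ d * m then discreteTerm β t t' μ m U (n + 1) else 0 with hf
  have hf0 : ∀ n ∉ Finset.range (L ^ d * m), f n = 0 := fun n hn => by
    simp only [Finset.mem_range, not_lt] at hn
    simp only [hf]
    rw [if_neg (by omega)]
  have h2 : ∑ n ∈ Finset.range (L ^ d * m), discreteTerm β t t' μ m U (n + 1) = ∑' n, f n := by
    rw [tsum_eq_sum hf0]
    refine Finset.sum_congr rfl fun n hn => ?_
    exact (if_pos (Nat.succ_le_of_lt (Finset.mem_range.1 hn))).symm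
  have hs : Summable fun n : ℕ => seriesTerm β t t' μ U (n + 1) :=
    (summable_norm_seriesTerm hβ U).of_norm
  rw [discretePartition, partitionSeries, h1, h2, add_sub_add_left_eq_sub,
    ← (summable_of_ne_finset_zero hf0).tsum_sub hs]
  refine tsum_congr fun n => ?_
  unfold detError
  rw [orderTerm_sub, seriesTerm_eq]
  congr 1
  simp only [hf]
  split_ifs
  · rw [discreteTerm_eq]
  · simp [orderTerm]

lemma tendsto_iSup_discretePartition (hβ : 0 < β) {r : ℝ} (hr : 0 ≤ r) :
    Tendsto (fun m : ℕ => ⨆ U ∈ {U : Coupling d L | ∀ 𝒳, ‖U 𝒳‖ ≤ r},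
      ‖discretePartition β t t' μ m U - partitionSeries β t t' μ U‖ₑ) atTop (𝓝 0) := by
  obtain ⟨K, hK, hb⟩ := exists_norm_covDet_le d L β t t' μ hβ
  set g : ℕ → ℝ := fun n => 2 * ((configCount d L * r * (K * β)) ^ (n + 1) / (n + 1).factorial)
    with hg
  have hgs : Summable g :=
    ((summable_nat_add_iff 1).2
      (Real.summable_pow_div_factorial (configCount d L * r * (K * β)))).mul_left 2
  have hbound : ∀ m : ℕ, 0 < m → ∀ n,
      orderBound r (detError (d := d) (L := L) β t t' μ m (n + 1)) ≤ g n := fun m hm n => by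
    refine (orderBound_le hr (norm_detError_le hβ hK hm (hb (n + 1)))).trans_eq ?_
    rw [hg]
    simp only [mul_pow]
    ring
  have hnonneg : ∀ m n, 0 ≤ orderBound r (detError (d := d) (L := L) β t t' μ m n) := fun m n => by
    unfold orderBound
    positivity
  have hlim : Tendsto (fun m => ∑' n : ℕ,
      orderBound r (detError (d := d) (L := L) β t t' μ m (n + 1))) atTop (𝓝 0) := by
    have h := tendsto_tsum_of_dominated_convergence (𝓕 := atTop)
      (f := fun m n => orderBound r (detError (d := d) (L := L) β t t' μ m (n + 1)))
      (g := fun _ => 0) hgs (fun n => tendsto_orderBound_detError hβ r (n + 1)) (by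
        filter_upwards [eventually_gt_atTop 0] with m hm n
        rw [Real.norm_of_nonneg (hnonneg m _)]
        exact hbound m hm n)
    simpa using h
  have hlim' := ENNReal.tendsto_ofReal hlim
  rw [ENNReal.ofReal_zero] at hlim'
  refine tendsto_of_tendsto_of_tendsto_of_le_of_le' tendsto_const_nhds hlim'
    (Eventually.of_forall fun _ => zero_le) ?_
  filter_upwards [eventually_gt_atTop 0] with m hm
  refine iSup₂_le fun U hU => ?_
  rw [← ofReal_norm, discretePartition_sub_partitionSeries hβ]
  refine ENNReal.ofReal_le_ofReal (tsum_of_norm_bounded (Summable.hasSum ?_) fun n =>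
    norm_orderTerm_le hU _)
  exact Summable.of_nonneg_of_le (fun n => hnonneg m _) (hbound m hm) hgs

end Convergence

end Hubbard

/-- The series `P` is well defined (its integrals exist and it converges absolutely) for all complex
couplings, and `P_h` converges to `P`, uniformly on every polydisc `|U_𝒳| ≤ r`, as `h = m / β` tends
to infinity through `ℕ / β`. The supremum is taken in `[0, ∞]`. -/
theorem proposition3p2 (d L : ℕ) [NeZero L] (hd : 1 ≤ d) (β t t' μ : ℝ) (hβ : 0 < β) :
    (∀ (n : ℕ) (X Y : Hubbard.Idx n → Hubbard.Site d L) (σ : Hubbard.Idx n → Hubbard.Spin),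
      IntegrableOn (fun s : Fin n → ℝ => Hubbard.covDet β t t' μ X Y σ (fun a => s a.1))
        (Set.Icc (0 : Fin n → ℝ) (fun _ => β))) ∧
    (∀ U : Hubbard.Coupling d L,
      Summable (fun n : ℕ => ‖Hubbard.seriesTerm β t t' μ U (n + 1)‖)) ∧
    (∀ r : ℝ, 0 < r →
      Tendsto
        (fun m : ℕ =>
          ⨆ U ∈ {U : Hubbard.Coupling d L | ∀ 𝒳, ‖U 𝒳‖ ≤ r},
            ‖Hubbard.discretePartition β t t' μ m U - Hubbard.partitionSeries β t t' μ U‖ₑ)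
        atTop (𝓝 0)) := by
  exact ⟨fun n X Y σ => Hubbard.integrableOn_covDet hβ X Y σ,
    fun U => Hubbard.summable_norm_seriesTerm hβ U,
    fun r hr => Hubbard.tendsto_iSup_discretePartition hβ hr.le⟩
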